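/- Let $\mathcal A=\{1,2,3\}$ and let $\mathcal A^*$ be the free monoid of words over $\mathcal A$. The Arnoux–Rauzy substitutions are the endomorphisms $\sigma_1,\sigma_2,\sigma_3$ of $\mathcal A^*$ given by $\sigma_i(i)=i$ and $\sigma_i(j)=ij$ for $j\ne i$. For a word $v$ let $\mathbf l(v)\in\mathbb Z^3$ be the vector whose $i$-th coordinate is the number of occurrences of $i$ in $v$, and for a substitution $\sigma$ over $\mathcal A$ let $M_\sigma$ be its incidence matrix, whose $j$-th column is $\mathbf l(\sigma(j))$; $\sigma$ is unimodular if $|\det M_\sigma|=1$. For a unimodular substitution $\sigma$ and $[\mathbf x,i]\in\mathbb Z^3\times\mathcal A$ put $$E_1^*(\sigma)[\mathbf x,i]=\{[M_\sigma^{-1}(\mathbf x+\mathbf l(p)),j] : j\in\mathcal A,\ p\in\mathcal A^*\text{ such that } pi\text{ is a prefix of }\sigma(j)\},$$ and $E_1^*(\sigma)Y=\bigcup_{[\mathbf x,i]\in Y}E_1^*(\sigma)[\mathbf x,i]$ for $Y\subset\mathbb Z^3\times\mathcal A$. Let $\mathcal U=\{[\mathbf 0,1],[\mathbf 0,2],[\mathbf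 0,3]\}$, and for $\mathbf w\in\mathbb R_{\ge0}^3\setminus\{\mathbf 0\}$ let $$\Gamma(\mathbf w)=\{[\mathbf x,i]\in\mathbb Z^3\times\mathcal A : 0\le\langle\mathbf x,\mathbf w\rangle<\langle\mathbf e_i,\mathbf w\rangle\}.$$ Let $\boldsymbol\tau=(\tau_n)_{n\ge0}$ be a sequence of Arnoux–Rauzy substitutions, that is, $\tau_n\in\{\sigma_1,\sigma_2,\sigma_3\}$ for each $n$. Set $\tau_{[0,n)}=\tau_0\circ\tau_1\circ\cdots\circ\tau_{n-1}$ and $M_{[0,n)}=M_{\tau_0}M_{\tau_1}\cdots M_{\tau_{n-1}}$. Suppose that $\boldsymbol\tau$ is recurrent, i.e. for each $m\in\mathbb N$ there is $n\ge1$ with $(\tau_0,\dots,\tau_{m-1})=(\tau_n,\dots,\tau_{n+m-1})$, and that each of $\sigma_1,\sigma_2,\sigma_3$ occurs in $\boldsymbol\tau$. Then $\boldsymbol\tau$ is a sequence of unimodular substitutions that satisfies the geometric finiteness property: for each $r>0$ there is $n_0\in\mathbb N$ such that for all $n\ge n_0$ $$\{[\mathbf x,i]\in\Gamma((M_{[0,n)})^t\,\mathbf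 1) : \|\mathbf x\|\le r\}\subset E_1^*(\tau_{[0,n)})\,\mathcal U,$$ where $\mathbf 1=(1,1,1)^t$ and $\|\cdot\|$ is the Euclidean norm. -/

import Mathlib

open scoped Matrix

namespace SAdic

/-- A (nonerasing) substitution over the alphabet `A`: an endomorphism of the free monoid of words
over `A`, given by the nonempty images of the letters. -/
@[ext]
structure Substitution (A : Type*) where
  /-- the image of a letter -/
  image : A → List A
  /-- images of letters are nonempty words -/
  image_ne_nil : ∀ a, image a ≠ []

namespace Substitution

variable {A : Type*}

/-- The image of a word: `σ (a₀ a₁ ⋯) = σ (a₀) σ (a₁) ⋯`. -/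
def onWord (σ : Substitution A) (v : List A) : List A := v.flatMap σ.image

/-- The identity substitution. -/
def id (A : Type*) : Substitution A where
  image a := [a]
  image_ne_nil _ := List.cons_ne_nil _ _

/-- The composition `σ ∘ τ`, i.e. `a ↦ σ (τ (a))`. -/
def comp (σ τ : Substitution A) : Substitution A where
  image a := σ.onWord (τ.image a)
  image_ne_nil a h := by
    obtain ⟨b, hb⟩ := List.exists_mem_of_ne_nil _ (τ.image_ne_nil a)
    exact σ.image_ne_nil b (List.flatMap_eq_nil_iff.1 h b hb)

/-- The block `σ_[0,n) = σ_0 ∘ σ_1 ∘ ⋯ ∘ σ_{n-1}` of a sequence of substitutions. -/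
def block (σ : ℕ → Substitution A) : ℕ → Substitution A
  | 0 => Substitution.id A
  | n + 1 => (block σ n).comp (σ n)

end Substitution

/-- The abelianization `l(v)` of a word: the vector of the numbers of occurrences of the letters. -/
def abel {A : Type*} [DecidableEq A] (v : List A) : A → ℤ := fun a => (v.count a : ℤ)

/-- The incidence matrix of `σ`, with `(i, j)` entry the number of letters `i` in `σ (j)`. -/
def incidence {A : Type*} [DecidableEq A] (σ : Substitution A) : Matrix A A ℤ :=
  Matrix.of fun i j => abel (σ.image j) i

/-- `σ` is unimodular: its incidence matrix has determinant `1` or `-1`. -/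
def IsUnimodular {A : Type*} [Fintype A] [DecidableEq A] (σ : Substitution A) : Prop :=
  |(incidence σ).det| = 1

/-- The product `M_[0,n) = M_0 M_1 ⋯ M_{n-1}` of the incidence matrices. -/
def incidenceBlock {A : Type*} [Fintype A] [DecidableEq A] (σ : ℕ → Substitution A) :
    ℕ → Matrix A A ℤ
  | 0 => 1
  | n + 1 => incidenceBlock σ n * incidence (σ n)

/-- The dual geometric realization on a single face:
`E₁*(σ)[x,i]` is the set of the `[M_σ⁻¹ (x + l(p)), j]` such that `p i` is a prefix of `σ (j)`. -/
def dualFace {A : Type*} [Fintype A] [DecidableEq A] (σ : Substitution A)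
    (f : (A → ℤ) × A) : Set ((A → ℤ) × A) :=
  {g | ∃ p : List A, p ++ [f.2] <+: σ.image g.2 ∧ g.1 = (incidence σ)⁻¹ *ᵥ (f.1 + abel p)}

/-- The dual geometric realization `E₁*(σ) Y`, the union of the `E₁*(σ)[x,i]` over `[x,i] ∈ Y`. -/
def dual {A : Type*} [Fintype A] [DecidableEq A] (σ : Substitution A)
    (Y : Set ((A → ℤ) × A)) : Set ((A → ℤ) × A) :=
  ⋃ f ∈ Y, dualFace σ f

/-- The seed `U = ⋃ i, [0,i]`. -/
def seed (A : Type*) : Set ((A → ℤ) × A) := {f | f.1 = 0}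

/-- The discrete hyperplane `Γ(w) = {[x,i] : 0 ≤ ⟨x, w⟩ < ⟨e_i, w⟩}`. -/
def discreteHyperplane {A : Type*} [Fintype A] (w : A → ℝ) : Set ((A → ℤ) × A) :=
  {f | 0 ≤ (fun a => (f.1 a : ℝ)) ⬝ᵥ w ∧ (fun a => (f.1 a : ℝ)) ⬝ᵥ w < w f.2}

/-- The vector `(M_[0,n))ᵗ 1`. -/
def normalVector {A : Type*} [Fintype A] [DecidableEq A] (σ : ℕ → Substitution A) (n : ℕ) :
    A → ℝ :=
  ((incidenceBlock σ n).map (Int.cast : ℤ → ℝ))ᵀ *ᵥ 1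

/-- The Euclidean norm of an integer vector. -/
noncomputable def euclNorm {A : Type*} [Fintype A] (x : A → ℤ) : ℝ :=
  ‖(WithLp.toLp 2 (fun a => (x a : ℝ)) : EuclideanSpace ℝ A)‖

/-- The geometric finiteness property of a sequence of unimodular substitutions: for each `r > 0`
the patches `E₁*(σ_[0,n)) U` contain, for all large `n`, the ball of radius `r` about the origin of
the discrete hyperplane `Γ((M_[0,n))ᵗ 1)`. -/
def GeometricFiniteness {A : Type*} [Fintype A] [DecidableEq A] (σ : ℕ → Substitution A) : Prop :=
  (∀ n, IsUnimodular (σ n)) ∧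
  ∀ r : ℝ, 0 < r → ∃ n₀ : ℕ, ∀ n, n₀ ≤ n →
    {f | f ∈ discreteHyperplane (normalVector σ n) ∧ euclNorm f.1 ≤ r} ⊆
      dual (Substitution.block σ n) (seed A)

/-- A sequence of substitutions is recurrent if each of its initial blocks `(σ_0, …, σ_{m-1})`
equals a block `(σ_n, …, σ_{n+m-1})` with `n ≥ 1`. -/
def Recurrent {A : Type*} (σ : ℕ → Substitution A) : Prop :=
  ∀ m : ℕ, ∃ n : ℕ, 1 ≤ n ∧ ∀ k, k < m → σ (n + k) = σ k

/-- The Arnoux-Rauzy substitution `σ_i` over three letters (written `0, 1, 2`): `i ↦ i`, and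
`j ↦ i j` for the letters `j ≠ i`. -/
def arnouxRauzy (i : Fin 3) : Substitution (Fin 3) where
  image j := if j = i then [i] else [i, j]
  image_ne_nil j := by split_ifs <;> simp

end SAdic

/-!
Write `h n = (M_[0,n))ᵗ 1` for the vector of lengths of the words `σ_[0,n) (i)`. A face `[x, i]` of
the discrete hyperplane `Γ (h n)` lies in the image of a unique face of `Γ (1)` under
`E₁*(σ_[0,n))`, and this face is obtained by desubstituting one letter at a time: for `σ_k` the
vector `x` is replaced by `M x` if `⟨M x, h⟩ < h k`, and by `M x - e_k` otherwise (`pullback`). So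
the claim is that the iterated pullback of every short vector `x` is `0` once `n` is large.

The entries of `h n` are positive and satisfy the strict triangle inequality. The pullback is
therefore defined on the slab `0 ≤ ⟨x, h⟩ ≤ (h 0 + h 1 + h 2 - 3) / 2`, which contains the vectors of
all faces of `Γ (h)`. Call two points of a slab neighbours if their difference `d` has `|d i| ≤ 1`
for all `i` and `|d 0 + d 1 + d 2| ≤ 1`. Three facts carry the proof.

* Pullback maps neighbours to neighbours (`Near.pullback_sub`). This is where the triangle
  inequality is used: it excludes differences such as `e_i + e_j`.
* A neighbour `d` of `0` is mapped to itself or to a vector with smaller `ℓ¹` norm, and for some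
  letter `i` the second case holds whenever the substitution is `σ_i` (`pullback_eq_or_l1_lt`,
  `exists_shortens`). By recurrence every letter occurs infinitely often, so all neighbours of `0`
  are pulled back to `0` over some finite range of levels (`exists_descend_near_eq_zero`).
* A point `x` of the slab is joined to `0` by a chain of at most `|x 0| + |x 1| + |x 2|`
  neighbours inside the slab (`exists_reach`).

A chain with `m + 1` links is thus shortened to a chain with `m` links over a finite range of
levels, and over sufficiently many levels it collapses to `0`.
-/

namespace SAdic

/-! ### Abelianization and incidence matrices -/

section Abelianization

theorem abel_append {A : Type*} [DecidableEq A] (u v : List A) : abel (u ++ v) = abel u + abel v := by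
  ext a; simp [abel]

variable {A : Type*} [Fintype A] [DecidableEq A]

theorem abel_onWord (σ : Substitution A) (v : List A) :
    abel (σ.onWord v) = incidence σ *ᵥ abel v := by
  induction v with
  | nil =>
    have h : abel ([] : List A) = 0 := by ext a; simp [abel]
    rw [show σ.onWord [] = [] from rfl, h, Matrix.mulVec_zero]
  | cons b v ih =>
    have h1 : σ.onWord (b :: v) = σ.image b ++ σ.onWord v := by simp [Substitution.onWord]
    have h2 : abel (b :: v) = Pi.single b 1 + abel v := by
      ext a
      by_cases h : a = b
      · subst h; simp [abel, add_comm]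
      · simp [abel, h, Ne.symm h]
    rw [h1, h2, abel_append, ih, Matrix.mulVec_add, Matrix.mulVec_single_one]
    rfl

theorem incidence_comp (σ τ : Substitution A) :
    incidence (σ.comp τ) = incidence σ * incidence τ := by
  ext i j
  have h := congrFun (abel_onWord σ (τ.image j)) i
  simpa [Matrix.mul_apply, Matrix.mulVec, dotProduct, incidence, Substitution.comp] using h

theorem incidence_block (σ : ℕ → Substitution A) (n : ℕ) :
    incidence (Substitution.block σ n) = incidenceBlock σ n := by
  induction n with
  | zero =>
    ext i j
    by_cases h : i = j
    · subst h; simp [incidence, abel, Substitution.block, Substitution.id, incidenceBlock]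
    · simp [incidence, abel, Substitution.block, Substitution.id, incidenceBlock, h, Ne.symm h]
  | succ n ih => rw [Substitution.block, incidence_comp, ih, incidenceBlock]

theorem isUnit_det_incidenceBlock {σ : ℕ → Substitution A} (h : ∀ n, IsUnimodular (σ n)) (n : ℕ) :
    IsUnit (incidenceBlock σ n).det := by
  induction n with
  | zero => simp [incidenceBlock]
  | succ n ih =>
    rw [incidenceBlock, Matrix.det_mul]
    exact ih.mul (Int.isUnit_iff_abs_eq.2 (h n))

/-- The vector `(M_[0,n))ᵗ 1` with integer entries: its `i`-th entry is the length of the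
word `σ_[0,n) (i)`. -/
def lengths (σ : ℕ → Substitution A) (n : ℕ) : A → ℤ := (incidenceBlock σ n)ᵀ *ᵥ 1

theorem lengths_zero (σ : ℕ → Substitution A) : lengths σ 0 = 1 := by
  simp [lengths, incidenceBlock]

theorem lengths_succ (σ : ℕ → Substitution A) (n : ℕ) :
    lengths σ (n + 1) = (incidence (σ n))ᵀ *ᵥ lengths σ n := by
  simp [lengths, incidenceBlock, Matrix.transpose_mul]

theorem normalVector_apply (σ : ℕ → Substitution A) (n : ℕ) (i : A) :
    normalVector σ n i = (lengths σ n i : ℝ) := by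
  simp [normalVector, lengths, Matrix.mulVec, dotProduct]

theorem mem_discreteHyperplane_iff (σ : ℕ → Substitution A) (n : ℕ) (f : (A → ℤ) × A) :
    f ∈ discreteHyperplane (normalVector σ n) ↔
      0 ≤ f.1 ⬝ᵥ lengths σ n ∧ f.1 ⬝ᵥ lengths σ n < lengths σ n f.2 := by
  have h : (fun a => (f.1 a : ℝ)) ⬝ᵥ normalVector σ n = ((f.1 ⬝ᵥ lengths σ n : ℤ) : ℝ) := by
    simp [dotProduct, normalVector_apply]
  simp only [discreteHyperplane, Set.mem_ofPred_eq, h, normalVector_apply]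
  norm_cast

end Abelianization

/-! ### Arnoux–Rauzy substitutions -/

theorem forall_fin_three {p : Fin 3 → Prop} : (∀ i, p i) ↔ p 0 ∧ p 1 ∧ p 2 := by
  simp [Fin.forall_fin_succ]

theorem exists_fin_three {p : Fin 3 → Prop} : (∃ i, p i) ↔ p 0 ∨ p 1 ∨ p 2 := by
  simp [Fin.exists_fin_succ]

theorem arnouxRauzy_injective : Function.Injective arnouxRauzy := by
  intro i j h
  by_contra hij
  have := congrArg (fun s => (s.image j).length) h
  simp [arnouxRauzy, Ne.symm hij] at this

theorem incidence_arnouxRauzy_apply :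
    ∀ k i j, incidence (arnouxRauzy k) i j = if i = k ∨ i = j then 1 else 0 := by
  intro k i j
  change (((arnouxRauzy k).image j).count i : ℤ) = _
  revert k i j
  decide

theorem isUnimodular_arnouxRauzy (k : Fin 3) : IsUnimodular (arnouxRauzy k) := by
  rw [IsUnimodular, Matrix.det_fin_three]
  simp only [incidence_arnouxRauzy_apply]
  revert k
  decide

theorem incidence_arnouxRauzy_mulVec (k : Fin 3) (x : Fin 3 → ℤ) (i : Fin 3) :
    (incidence (arnouxRauzy k) *ᵥ x) i = if i = k then x 0 + x 1 + x 2 else x i := by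
  simp only [Matrix.mulVec, dotProduct, Fin.sum_univ_three, incidence_arnouxRauzy_apply]
  fin_cases k <;> fin_cases i <;> simp

theorem incidence_arnouxRauzy_transpose_mulVec (k : Fin 3) (h : Fin 3 → ℤ) (i : Fin 3) :
    ((incidence (arnouxRauzy k))ᵀ *ᵥ h) i = if i = k then h k else h i + h k := by
  simp only [Matrix.mulVec, dotProduct, Fin.sum_univ_three, Matrix.transpose_apply,
    incidence_arnouxRauzy_apply]
  fin_cases k <;> fin_cases i <;> simp <;> ring

theorem dotProduct_transpose_mulVec (k : Fin 3) (x h : Fin 3 → ℤ) :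
    x ⬝ᵥ ((incidence (arnouxRauzy k))ᵀ *ᵥ h) = (incidence (arnouxRauzy k) *ᵥ x) ⬝ᵥ h := by
  rw [Matrix.mulVec_transpose, dotProduct_comm, ← Matrix.dotProduct_mulVec, dotProduct_comm]

/-! ### Slabs and the pullback -/

/-- Positive entries that satisfy the strict triangle inequality. -/
structure Triangular (h : Fin 3 → ℤ) : Prop where
  pos : ∀ i, 0 < h i
  two_mul_lt : ∀ i, 2 * h i < h 0 + h 1 + h 2

theorem Triangular.transpose_mulVec {h : Fin 3 → ℤ} (hh : Triangular h) (k : Fin 3) :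
    Triangular ((incidence (arnouxRauzy k))ᵀ *ᵥ h) := by
  have p0 := hh.pos 0
  have p1 := hh.pos 1
  have p2 := hh.pos 2
  have q0 := hh.two_mul_lt 0
  have q1 := hh.two_mul_lt 1
  have q2 := hh.two_mul_lt 2
  constructor <;> intro i <;> simp only [incidence_arnouxRauzy_transpose_mulVec] <;>
    fin_cases k <;> fin_cases i <;> simp <;> omega

/-- The integer points `x` with `0 ≤ ⟨x, h⟩ ≤ (h 0 + h 1 + h 2 - 3) / 2`. -/
def slab (h : Fin 3 → ℤ) : Set (Fin 3 → ℤ) :=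
  {x | 0 ≤ x ⬝ᵥ h ∧ 2 * (x ⬝ᵥ h) + 3 ≤ h 0 + h 1 + h 2}

theorem zero_mem_slab {h : Fin 3 → ℤ} (hh : Triangular h) : 0 ∈ slab h := by
  have p0 := hh.pos 0
  have p1 := hh.pos 1
  have p2 := hh.pos 2
  simp only [slab, Set.mem_ofPred_eq, zero_dotProduct]
  omega

/-- The vector `M x - l(p)` of the face of `Γ (h)` whose image under `E₁*(σ_k)` contains a face with
vector `x`; here `p` is the empty word or the word `k`. -/
def pullback (h : Fin 3 → ℤ) (k : Fin 3) (x : Fin 3 → ℤ) : Fin 3 → ℤ :=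
  if (incidence (arnouxRauzy k) *ᵥ x) ⬝ᵥ h < h k then incidence (arnouxRauzy k) *ᵥ x
  else incidence (arnouxRauzy k) *ᵥ x - Pi.single k 1

theorem pullback_zero {h : Fin 3 → ℤ} (hh : Triangular h) (k : Fin 3) : pullback h k 0 = 0 := by
  simp [pullback, hh.pos k]

theorem pullback_mem_slab {h : Fin 3 → ℤ} (hh : Triangular h) {k : Fin 3} {x : Fin 3 → ℤ}
    (hx : x ∈ slab ((incidence (arnouxRauzy k))ᵀ *ᵥ h)) : pullback h k x ∈ slab h := by
  obtain ⟨h1, h2⟩ := hx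
  rw [dotProduct_transpose_mulVec] at h1 h2
  have hk := hh.two_mul_lt k
  have hs : ((incidence (arnouxRauzy k))ᵀ *ᵥ h) 0 + ((incidence (arnouxRauzy k))ᵀ *ᵥ h) 1 +
      ((incidence (arnouxRauzy k))ᵀ *ᵥ h) 2 = h 0 + h 1 + h 2 + 2 * h k := by
    simp only [incidence_arnouxRauzy_transpose_mulVec]
    fin_cases k <;> simp <;> ring
  rw [hs] at h2
  simp only [pullback, slab, Set.mem_ofPred_eq]
  split_ifs with hlt
  · omega
  · rw [sub_dotProduct, single_dotProduct, one_mul]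
    omega

/-! ### Neighbours in a slab -/

/-- The differences of neighbouring points. -/
def Near (d : Fin 3 → ℤ) : Prop := (∀ i, |d i| ≤ 1) ∧ |d 0 + d 1 + d 2| ≤ 1

/-- The coordinate form of `Near.pullback_sub`: `c` is the coordinate of the difference that
belongs to the letter of the substitution, `t` and `u` are the heights of the two points, and
`e` and `f` are what the pullback subtracts from that coordinate. -/
theorem near_pullback_aux {a b c ha hb hc t u e f : ℤ} (pa : 0 < ha) (pb : 0 < hb)
    (qa : 2 * ha < ha + hb + hc) (qb : 2 * hb < ha + hb + hc) (qc : 2 * hc < ha + hb + hc)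
    (ba : |a| ≤ 1) (bb : |b| ≤ 1) (bc : |c| ≤ 1) (bs : |a + b + c| ≤ 1)
    (htu : t - u = a * ha + b * hb + (a + b + c) * hc)
    (t0 : 0 ≤ t) (t1 : 2 * t + 3 ≤ ha + hb + hc + 2 * hc)
    (u0 : 0 ≤ u) (u1 : 2 * u + 3 ≤ ha + hb + hc + 2 * hc)
    (he : t < hc ∧ e = 0 ∨ hc ≤ t ∧ e = 1) (hf : u < hc ∧ f = 0 ∨ hc ≤ u ∧ f = 1) :
    |a + b + c - (e - f)| ≤ 1 ∧ |a + b + (a + b + c - (e - f))| ≤ 1 := by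
  rw [abs_le] at *
  obtain ⟨a0, a1⟩ := ba
  obtain ⟨b0, b1⟩ := bb
  obtain ⟨c0, c1⟩ := bc
  rw [abs_le]
  interval_cases a <;> interval_cases b <;> interval_cases c <;> omega

theorem pullback_apply (h : Fin 3 → ℤ) (k : Fin 3) (x : Fin 3 → ℤ) (i : Fin 3) :
    pullback h k x i = if i = k then x 0 + x 1 + x 2 -
      (if (incidence (arnouxRauzy k) *ᵥ x) ⬝ᵥ h < h k then 0 else 1) else x i := by
  unfold pullback
  split_ifs with h1 h2 h2 <;>
    simp [incidence_arnouxRauzy_mulVec, h2]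

theorem incidence_arnouxRauzy_mulVec_dotProduct (k : Fin 3) (x h : Fin 3 → ℤ) :
    (incidence (arnouxRauzy k) *ᵥ x) ⬝ᵥ h =
      x 0 * h 0 + x 1 * h 1 + x 2 * h 2 + (x 0 + x 1 + x 2 - x k) * h k := by
  simp only [dotProduct, Fin.sum_univ_three, incidence_arnouxRauzy_mulVec]
  fin_cases k <;> simp <;> ring

theorem Near.pullback_sub {h : Fin 3 → ℤ} (hh : Triangular h) {k : Fin 3} {x y : Fin 3 → ℤ}
    (hx : x ∈ slab ((incidence (arnouxRauzy k))ᵀ *ᵥ h))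
    (hy : y ∈ slab ((incidence (arnouxRauzy k))ᵀ *ᵥ h)) (hxy : Near (x - y)) :
    Near (pullback h k x - pullback h k y) := by
  obtain ⟨x0, x1⟩ := hx
  obtain ⟨y0, y1⟩ := hy
  rw [dotProduct_transpose_mulVec] at x0 x1 y0 y1
  simp only [incidence_arnouxRauzy_transpose_mulVec] at x1 y1
  obtain ⟨hb, hs⟩ := hxy
  have htu : (incidence (arnouxRauzy k) *ᵥ x) ⬝ᵥ h - (incidence (arnouxRauzy k) *ᵥ y) ⬝ᵥ h =
      (x 0 - y 0) * h 0 + (x 1 - y 1) * h 1 + (x 2 - y 2) * h 2 +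
      (x 0 - y 0 + (x 1 - y 1) + (x 2 - y 2) - (x k - y k)) * h k := by
    rw [incidence_arnouxRauzy_mulVec_dotProduct, incidence_arnouxRauzy_mulVec_dotProduct]
    ring
  have key : ∀ t : ℤ, t < h k ∧ (if t < h k then 0 else 1 : ℤ) = 0 ∨
      h k ≤ t ∧ (if t < h k then 0 else 1 : ℤ) = 1 := by
    intro t
    split_ifs <;> omega
  have ex := key ((incidence (arnouxRauzy k) *ᵥ x) ⬝ᵥ h)
  have ey := key ((incidence (arnouxRauzy k) *ᵥ y) ⬝ᵥ h)
  simp only [Near, Pi.sub_apply, pullback_apply, forall_fin_three] at hb hs ⊢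
  generalize (incidence (arnouxRauzy k) *ᵥ x) ⬝ᵥ h = t at *
  generalize (incidence (arnouxRauzy k) *ᵥ y) ⬝ᵥ h = u at *
  generalize (if t < h k then 0 else 1 : ℤ) = e at *
  generalize (if u < h k then 0 else 1 : ℤ) = f at *
  obtain ⟨b0, b1, b2⟩ := hb
  have p0 := hh.pos 0
  have p1 := hh.pos 1
  have p2 := hh.pos 2
  have q0 := hh.two_mul_lt 0
  have q1 := hh.two_mul_lt 1
  have q2 := hh.two_mul_lt 2
  fin_cases k <;> simp at x1 y1 htu ex ey ⊢
  · have := near_pullback_aux p1 p2 (by linarith) (by linarith) (by linarith) b1 b2 b0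
      (by convert hs using 2; ring) (by rw [htu]; ring) x0 (by linarith) y0 (by linarith) ex ey
    refine ⟨⟨?_, b1, b2⟩, ?_⟩
    · convert this.1 using 2; ring
    · convert this.2 using 2; ring
  · have := near_pullback_aux p0 p2 (by linarith) (by linarith) (by linarith) b0 b2 b1
      (by convert hs using 2; ring) (by rw [htu]; ring) x0 (by linarith) y0 (by linarith) ex ey
    refine ⟨⟨b0, ?_, b2⟩, ?_⟩
    · convert this.1 using 2; ring
    · convert this.2 using 2; ring
  · have := near_pullback_aux p0 p1 (by linarith) (by linarith) (by linarith) b0 b1 b2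
      (by convert hs using 2) (by rw [htu]; ring) x0 (by linarith) y0 (by linarith) ex ey
    refine ⟨⟨b0, b1, ?_⟩, ?_⟩
    · convert this.1 using 2; ring
    · convert this.2 using 2; ring

/-- The `ℓ¹` norm. -/
def l1 (x : Fin 3 → ℤ) : ℕ := (x 0).natAbs + (x 1).natAbs + (x 2).natAbs

theorem l1_eq_zero {x : Fin 3 → ℤ} (hx : l1 x = 0) : x = 0 := by
  simp only [l1, Nat.add_eq_zero_iff, Int.natAbs_eq_zero] at hx
  ext i
  fin_cases i
  exacts [hx.1.1, hx.1.2, hx.2]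

/-- In coordinates: a neighbour `(a, b, c)` of `0` at height `t` is fixed by the pullback or its
norm drops; `c` is the coordinate of the letter of the substitution. The norm drops if `c` is the
only positive coordinate. The case that `c` is negative and the others are positive does not
occur: it would give `t = ha + hb + hc`, a height outside the slab. -/
theorem l1_pullback_aux {a b c ha hb hc t e : ℤ} (pa : 0 < ha) (pb : 0 < hb) (pc : 0 < hc)
    (qa : 2 * ha < ha + hb + hc) (qb : 2 * hb < ha + hb + hc) (qc : 2 * hc < ha + hb + hc)
    (ba : |a| ≤ 1) (bb : |b| ≤ 1) (bc : |c| ≤ 1) (bs : |a + b + c| ≤ 1)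
    (ht : t = a * ha + b * hb + (a + b + c) * hc)
    (t0 : 0 ≤ t) (t1 : 2 * t + 3 ≤ ha + hb + hc + 2 * hc)
    (he : t < hc ∧ e = 0 ∨ hc ≤ t ∧ e = 1) :
    (a + b + c - e = c ∨ (a + b + c - e).natAbs < c.natAbs) ∧
      (0 < c ∧ a ≤ 0 ∧ b ≤ 0 ∨ c < 0 ∧ 0 < a ∧ 0 < b → (a + b + c - e).natAbs < c.natAbs) := by
  rw [abs_le] at *
  obtain ⟨a0, a1⟩ := ba
  obtain ⟨b0, b1⟩ := bb
  obtain ⟨c0, c1⟩ := bc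
  interval_cases a <;> interval_cases b <;> interval_cases c <;> omega

/-- The letters whose substitution shortens the neighbour `d` of `0` by pullback, or cannot occur at
a level whose slab contains `d`: the letter of the only positive coordinate, or of the only
coordinate that is not positive, if that one is negative. -/
def Shortens (d : Fin 3 → ℤ) (k : Fin 3) : Prop :=
  (0 < d k ∧ ∀ i, i ≠ k → d i ≤ 0) ∨ (d k < 0 ∧ ∀ i, i ≠ k → 0 < d i)

theorem pullback_eq_or_l1_lt {h : Fin 3 → ℤ} (hh : Triangular h) {k : Fin 3} {d : Fin 3 → ℤ}
    (hd : d ∈ slab ((incidence (arnouxRauzy k))ᵀ *ᵥ h)) (hn : Near d) :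
    (pullback h k d = d ∨ l1 (pullback h k d) < l1 d) ∧
      (Shortens d k → l1 (pullback h k d) < l1 d) := by
  obtain ⟨x0, x1⟩ := hd
  rw [dotProduct_transpose_mulVec] at x0 x1
  simp only [incidence_arnouxRauzy_transpose_mulVec] at x1
  obtain ⟨hb, hs⟩ := hn
  have ht := incidence_arnouxRauzy_mulVec_dotProduct k d h
  have key : ∀ t : ℤ, t < h k ∧ (if t < h k then 0 else 1 : ℤ) = 0 ∨
      h k ≤ t ∧ (if t < h k then 0 else 1 : ℤ) = 1 := by
    intro t
    split_ifs <;> omega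
  have ex := key ((incidence (arnouxRauzy k) *ᵥ d) ⬝ᵥ h)
  simp only [Shortens, l1, funext_iff, pullback_apply, forall_fin_three] at hb ⊢
  generalize (incidence (arnouxRauzy k) *ᵥ d) ⬝ᵥ h = t at *
  generalize (if t < h k then 0 else 1 : ℤ) = e at *
  obtain ⟨b0, b1, b2⟩ := hb
  have p0 := hh.pos 0
  have p1 := hh.pos 1
  have p2 := hh.pos 2
  have q0 := hh.two_mul_lt 0
  have q1 := hh.two_mul_lt 1
  have q2 := hh.two_mul_lt 2
  fin_cases k <;> simp at x1 ht ex ⊢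
  · have := l1_pullback_aux p1 p2 p0 (by linarith) (by linarith) (by linarith) b1 b2 b0
      (by convert hs using 2; ring) (by rw [ht]; ring) x0 (by linarith) ex
    omega
  · have := l1_pullback_aux p0 p2 p1 (by linarith) (by linarith) (by linarith) b0 b2 b1
      (by convert hs using 2; ring) (by rw [ht]; ring) x0 (by linarith) ex
    omega
  · have := l1_pullback_aux p0 p1 p2 (by linarith) (by linarith) (by linarith) b0 b1 b2
      hs (by rw [ht]; ring) x0 (by linarith) ex
    omega

theorem exists_shortens {h : Fin 3 → ℤ} (hh : Triangular h) {d : Fin 3 → ℤ} (hd : d ∈ slab h)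
    (hn : Near d) (h0 : d ≠ 0) : ∃ k, Shortens d k := by
  obtain ⟨t0, t1⟩ := hd
  obtain ⟨hb, hs⟩ := hn
  have hne : ¬ (d 0 = 0 ∧ d 1 = 0 ∧ d 2 = 0) := fun hz =>
    h0 (funext (forall_fin_three.2 hz))
  have p0 := hh.pos 0
  have p1 := hh.pos 1
  have p2 := hh.pos 2
  have q0 := hh.two_mul_lt 0
  have q1 := hh.two_mul_lt 1
  have q2 := hh.two_mul_lt 2
  simp only [Shortens, dotProduct, Fin.sum_univ_three, forall_fin_three, exists_fin_three,
    abs_le] at *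
  simp
  generalize d 0 = a at *
  generalize d 1 = b at *
  generalize d 2 = c at *
  obtain ⟨⟨a0, a1⟩, ⟨b0, b1⟩, c0, c1⟩ := hb
  interval_cases a <;> interval_cases b <;> interval_cases c <;> omega

/-! ### Chains of neighbours -/

/-- `Reach h m x`: the point `x` is joined to `0` by a chain of `m` neighbours in the slab. -/
def Reach (h : Fin 3 → ℤ) : ℕ → (Fin 3 → ℤ) → Prop
  | 0, x => x = 0
  | m + 1, x => x ∈ slab h ∧ ∃ y, Reach h m y ∧ Near (x - y)

theorem Reach.mem_slab {h : Fin 3 → ℤ} (hh : Triangular h) {m : ℕ} {x : Fin 3 → ℤ}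
    (hx : Reach h m x) : x ∈ slab h := by
  cases m with
  | zero => rw [show x = 0 from hx]; exact zero_mem_slab hh
  | succ m => exact hx.1

theorem Reach.pullback {h : Fin 3 → ℤ} (hh : Triangular h) {k : Fin 3} {m : ℕ} {x : Fin 3 → ℤ}
    (hx : Reach ((incidence (arnouxRauzy k))ᵀ *ᵥ h) m x) : Reach h m (pullback h k x) := by
  induction m generalizing x with
  | zero => rw [show x = 0 from hx]; exact pullback_zero hh k
  | succ m ih =>
    obtain ⟨hx, y, hy, hxy⟩ := hx
    exact ⟨pullback_mem_slab hh hx, _, ih hy,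
      hxy.pullback_sub hh hx (hy.mem_slab (hh.transpose_mulVec k))⟩

/-- A nonzero point of the slab has a neighbour of smaller norm: a positive coordinate is
lowered, or a negative one is raised, and if both leave the slab they are done together. -/
theorem exists_near_l1_lt {h : Fin 3 → ℤ} (hh : Triangular h) {x : Fin 3 → ℤ} (hx : x ∈ slab h)
    (h0 : x ≠ 0) : ∃ y ∈ slab h, Near (x - y) ∧ l1 y < l1 x := by
  obtain ⟨t0, t1⟩ := hx
  have hsum : x ⬝ᵥ h = x 0 * h 0 + x 1 * h 1 + x 2 * h 2 := by
    simp [dotProduct, Fin.sum_univ_three]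
  have hpos : ∃ i, 0 < x i := by
    by_contra! hle
    have hm : ∀ i, x i * h i ≤ 0 := fun i => mul_nonpos_of_nonpos_of_nonneg (hle i) (hh.pos i).le
    have m0 := hm 0
    have m1 := hm 1
    have m2 := hm 2
    have hz : ∀ i, x i * h i = 0 := forall_fin_three.2 (by omega)
    exact h0 (funext fun i => (mul_eq_zero.1 (hz i)).resolve_right (hh.pos i).ne')
  obtain ⟨i, hi⟩ := hpos
  by_cases hti : h i ≤ x ⬝ᵥ h
  · refine ⟨x - Pi.single i 1, ?_, ?_, ?_⟩
    · have := hh.pos i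
      simp only [slab, Set.mem_ofPred_eq, sub_dotProduct, single_dotProduct, one_mul]
      omega
    · rw [sub_sub_cancel]
      fin_cases i <;> simp [Near, forall_fin_three]
    · fin_cases i <;> simp [l1] at hi ⊢ <;> omega
  have hneg : ∃ j, x j < 0 := by
    by_contra! hge
    have hm : ∀ i, 0 ≤ x i * h i := fun i => mul_nonneg (hge i) (hh.pos i).le
    have m0 := hm 0
    have m1 := hm 1
    have m2 := hm 2
    have hle : h i ≤ x i * h i := le_mul_of_one_le_left (hh.pos i).le hi
    apply hti
    fin_cases i <;> simp at hle ⊢ <;> omega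
  obtain ⟨j, hj⟩ := hneg
  have pj := hh.pos j
  have qj := hh.two_mul_lt j
  by_cases htj : 2 * (x ⬝ᵥ h + h j) + 3 ≤ h 0 + h 1 + h 2
  · refine ⟨x + Pi.single j 1, ?_, ?_, ?_⟩
    · simp only [slab, Set.mem_ofPred_eq, add_dotProduct, single_dotProduct, one_mul]
      omega
    · rw [sub_add_cancel_left]
      fin_cases j <;> simp [Near, forall_fin_three]
    · fin_cases j <;> simp [l1] at hj ⊢ <;> omega
  · refine ⟨x - (Pi.single i 1 - Pi.single j 1), ?_, ?_, ?_⟩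
    · have qi := hh.two_mul_lt i
      simp only [slab, Set.mem_ofPred_eq, sub_dotProduct, single_dotProduct, one_mul]
      omega
    · rw [sub_sub_cancel]
      fin_cases i <;> fin_cases j <;> simp [Near, forall_fin_three]
    · fin_cases i <;> fin_cases j <;> simp [l1] at hi hj ⊢ <;> omega

theorem exists_reach {h : Fin 3 → ℤ} (hh : Triangular h) {x : Fin 3 → ℤ} (hx : x ∈ slab h) :
    ∃ m ≤ l1 x, Reach h m x := by
  induction hn : l1 x using Nat.strong_induction_on generalizing x with
  | _ n ih =>
    by_cases h0 : x = 0
    · exact ⟨0, Nat.zero_le _, h0⟩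
    · obtain ⟨y, hy, hxy, hlt⟩ := exists_near_l1_lt hh hx h0
      obtain ⟨m, hm, hr⟩ := ih (l1 y) (hn ▸ hlt) hy rfl
      exact ⟨m + 1, by omega, hx, y, hr, hxy⟩

/-! ### Iterated pullback -/

section Descend

/-- The iterated pullback from level `q + l` to level `q`. -/
def descend (h : ℕ → Fin 3 → ℤ) (a : ℕ → Fin 3) (q : ℕ) : ℕ → (Fin 3 → ℤ) → Fin 3 → ℤ
  | 0, x => x
  | l + 1, x => descend h a q l (pullback (h (q + l)) (a (q + l)) x)

theorem descend_add (h : ℕ → Fin 3 → ℤ) (a : ℕ → Fin 3) (q l m : ℕ) (x : Fin 3 → ℤ) :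
    descend h a q (l + m) x = descend h a q l (descend h a (q + l) m x) := by
  induction m generalizing x with
  | zero => rfl
  | succ m ih => rw [← add_assoc, descend, ih, descend, add_assoc]

variable {h : ℕ → Fin 3 → ℤ} {a : ℕ → Fin 3} (hT : ∀ n, Triangular (h n))
  (hS : ∀ n, h (n + 1) = (incidence (arnouxRauzy (a n)))ᵀ *ᵥ h n)

include hT hS

theorem Reach.descend {q l m : ℕ} {x : Fin 3 → ℤ} (hx : Reach (h (q + l)) m x) :
    Reach (h q) m (descend h a q l x) := by
  induction l generalizing x with
  | zero => exact hx
  | succ l ih =>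
    rw [← add_assoc, hS] at hx
    exact ih (hx.pullback (hT _))

theorem Near.descend_sub {q l : ℕ} {x y : Fin 3 → ℤ} (hx : x ∈ slab (h (q + l)))
    (hy : y ∈ slab (h (q + l))) (hxy : Near (x - y)) :
    Near (SAdic.descend h a q l x - SAdic.descend h a q l y) := by
  induction l generalizing x y with
  | zero => exact hxy
  | succ l ih =>
    rw [← add_assoc, hS] at hx hy
    exact ih (pullback_mem_slab (hT _) hx) (pullback_mem_slab (hT _) hy)
      (hxy.pullback_sub (hT _) hx hy)

theorem descend_eq_or_l1_lt {q l : ℕ} {d : Fin 3 → ℤ} (hd : Reach (h (q + l)) 1 d) :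
    (descend h a q l d = d ∧ ∀ n, q ≤ n → n < q + l → ¬ Shortens d (a n)) ∨
      l1 (descend h a q l d) < l1 d := by
  induction l generalizing d with
  | zero => exact Or.inl ⟨rfl, fun n h1 h2 => absurd h2 (by omega)⟩
  | succ l ih =>
    rw [← add_assoc, hS] at hd
    have hp := ih (hd.pullback (hT _))
    obtain ⟨hs, y, hy, hn⟩ := hd
    rw [show y = 0 from hy, sub_zero] at hn
    obtain ⟨hc, hsh⟩ := pullback_eq_or_l1_lt (hT _) hs hn
    rw [descend]
    rcases hc with hc | hc
    · rw [hc] at hp hsh ⊢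
      refine hp.imp_left fun ⟨h1, h2⟩ => ⟨h1, fun n hn1 hn2 hsn => ?_⟩
      rcases (by omega : n < q + l ∨ n = q + l) with hlt | rfl
      · exact h2 n hn1 hlt hsn
      · exact lt_irrefl _ (hsh hsn)
    · rcases hp with ⟨h1, -⟩ | h1
      · rw [h1]; exact Or.inr hc
      · exact Or.inr (h1.trans hc)

/-- A chain loses a link if all neighbours of `0` are pulled back to `0`. -/
theorem Reach.descend_of_near {q l m : ℕ} (hz : ∀ d, Reach (h (q + l)) 1 d →
    SAdic.descend h a q l d = 0)
    {x : Fin 3 → ℤ} (hx : Reach (h (q + l)) (m + 1) x) :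
    Reach (h q) m (SAdic.descend h a q l x) := by
  induction m generalizing x with
  | zero => exact hz x hx
  | succ m ih =>
    have hx' := (hx.descend hT hS).mem_slab (hT q)
    obtain ⟨hx, y, hy, hxy⟩ := hx
    exact ⟨hx', _, ih hy, hxy.descend_sub hT hS hx (hy.mem_slab (hT _))⟩

variable (hI : ∀ i q, ∃ n, q ≤ n ∧ a n = i)

include hI

theorem exists_l1_descend_lt (q : ℕ) :
    ∃ L, ∀ l, L ≤ l → ∀ d, Reach (h (q + l)) 1 d → d ≠ 0 → l1 (descend h a q l d) < l1 d := by
  choose N hN1 hN2 using hI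
  refine ⟨N 0 q + N 1 q + N 2 q + 1, fun l hl d hd h0 => ?_⟩
  have hlt : ∀ i, N i q < q + l := forall_fin_three.2 (by omega)
  rcases descend_eq_or_l1_lt hT hS hd with ⟨-, hno⟩ | hlt
  · obtain ⟨hs, y, hy, hn⟩ := hd
    rw [show y = 0 from hy, sub_zero] at hn
    obtain ⟨k, hk⟩ := exists_shortens (hT _) hs hn h0
    exact absurd ((hN2 k q).symm ▸ hk) (hno _ (hN1 k q) (hlt k))
  · exact hlt

theorem exists_descend_near_eq_zero (q : ℕ) :
    ∃ L, ∀ l, L ≤ l → ∀ d, Reach (h (q + l)) 1 d → descend h a q l d = 0 := by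
  have zero : ∀ q l, descend h a q l 0 = 0 := fun q l =>
    Reach.descend hT hS (q := q) (l := l) (m := 0) rfl
  -- The norm drops at least by one over each of finitely many consecutive ranges of levels.
  have main : ∀ s q, ∃ L, ∀ l, L ≤ l → ∀ d, Reach (h (q + l)) 1 d → l1 d ≤ s →
      descend h a q l d = 0 := by
    intro s
    induction s with
    | zero =>
      refine fun q => ⟨0, fun l _ d _ hd => ?_⟩
      rw [l1_eq_zero (Nat.le_zero.1 hd), zero]
    | succ s ih =>
      intro q
      obtain ⟨L, hL⟩ := ih q
      obtain ⟨K, hK⟩ := exists_l1_descend_lt hT hS hI (q + L)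
      refine ⟨L + K, fun l hl d hd hs => ?_⟩
      obtain ⟨m, rfl⟩ := Nat.exists_eq_add_of_le (show L ≤ l by omega)
      rw [descend_add]
      by_cases h0 : d = 0
      · rw [h0, zero, zero]
      · rw [← add_assoc] at hd
        have := hK m (by omega) d hd h0
        exact hL L le_rfl _ (hd.descend hT hS) (by omega)
  -- A neighbour of `0` has three coordinates of absolute value at most one.
  obtain ⟨L, hL⟩ := main 3 q
  refine ⟨L, fun l hl d hd => hL l hl d hd ?_⟩
  obtain ⟨-, y, hy, hn, -⟩ := hd
  rw [show y = 0 from hy, sub_zero] at hn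
  have n0 := abs_le.1 (hn 0)
  have n1 := abs_le.1 (hn 1)
  have n2 := abs_le.1 (hn 2)
  simp only [l1]
  omega

theorem exists_descend_eq_zero (m : ℕ) :
    ∃ N, ∀ n, N ≤ n → ∀ x, Reach (h n) m x → descend h a 0 n x = 0 := by
  induction m with
  | zero =>
    refine ⟨0, fun n _ x hx => ?_⟩
    rw [← zero_add n] at hx
    exact Reach.descend hT hS hx
  | succ m ih =>
    obtain ⟨N, hN⟩ := ih
    obtain ⟨L, hL⟩ := exists_descend_near_eq_zero hT hS hI N
    refine ⟨N + L, fun n hn x hx => ?_⟩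
    obtain ⟨l, rfl⟩ := Nat.exists_eq_add_of_le (show N ≤ n by omega)
    rw [descend_add, zero_add]
    exact hN N le_rfl _ (hx.descend_of_near hT hS (hL l (by omega)))

end Descend

/-! ### Faces and prefixes -/

theorem triangular_lengths {σ : ℕ → Substitution (Fin 3)} {a : ℕ → Fin 3}
    (ha : ∀ n, σ n = arnouxRauzy (a n)) (n : ℕ) : Triangular (lengths σ n) := by
  induction n with
  | zero => rw [lengths_zero]; constructor <;> simp
  | succ n ih => rw [lengths_succ, ha]; exact ih.transpose_mulVec _

/-- Desubstitution of a face: the pullback of its vector to level `0` is what is missing for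
`M_[0,n) x` to be the abelianization of a prefix of `σ_[0,n) (i)`. -/
theorem exists_prefix {σ : ℕ → Substitution (Fin 3)} {a : ℕ → Fin 3}
    (ha : ∀ n, σ n = arnouxRauzy (a n)) (n : ℕ) (x : Fin 3 → ℤ) (i : Fin 3)
    (h0 : 0 ≤ x ⬝ᵥ lengths σ n) (h1 : x ⬝ᵥ lengths σ n < lengths σ n i) :
    ∃ p j, p ++ [j] <+: (Substitution.block σ n).image i ∧
      incidenceBlock σ n *ᵥ x = abel p + descend (lengths σ) a 0 n x := by
  induction n generalizing x i with
  | zero =>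
    exact ⟨[], i, List.prefix_rfl, by ext b; simp [incidenceBlock, abel, descend]⟩
  | succ n ih =>
    rw [lengths_succ, ha] at h0 h1
    rw [dotProduct_transpose_mulVec] at h0 h1
    rw [incidence_arnouxRauzy_transpose_mulVec] at h1
    -- The word `q` is empty or consists of the letter `a n`, as the height of `M x` decides.
    have step : ∃ q j, q ++ [j] <+: (σ n).image i ∧
        incidence (σ n) *ᵥ x = abel q + pullback (lengths σ n) (a n) x ∧
        0 ≤ pullback (lengths σ n) (a n) x ⬝ᵥ lengths σ n ∧
        pullback (lengths σ n) (a n) x ⬝ᵥ lengths σ n < lengths σ n j := by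
      rw [ha]
      unfold pullback
      by_cases hlt : (incidence (arnouxRauzy (a n)) *ᵥ x) ⬝ᵥ lengths σ n < lengths σ n (a n)
      · rw [if_pos hlt]
        refine ⟨[], a n, ?_, by ext b; simp [abel], h0, hlt⟩
        by_cases hi : i = a n <;> simp [arnouxRauzy, hi]
      · have hi : i ≠ a n := fun hi => hlt (by rwa [if_pos hi] at h1)
        rw [if_neg hi] at h1
        rw [if_neg hlt]
        refine ⟨[a n], i, by simp [arnouxRauzy, hi], ?_, ?_, ?_⟩
        · have : abel [a n] = Pi.single (a n) 1 := by
            ext b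
            by_cases hb : b = a n
            · subst hb; simp [abel]
            · simp [abel, hb, Ne.symm hb]
          rw [this, add_sub_cancel]
        · rw [sub_dotProduct, single_dotProduct, one_mul]; omega
        · rw [sub_dotProduct, single_dotProduct, one_mul]; omega
    obtain ⟨q, j, ⟨s, hs⟩, hq, g0, g1⟩ := step
    obtain ⟨p, b, ⟨r, hr⟩, hp⟩ := ih _ j g0 g1
    refine ⟨(Substitution.block σ n).onWord q ++ p, b,
      ⟨r ++ (Substitution.block σ n).onWord s, ?_⟩, ?_⟩
    · simp only [Substitution.block, Substitution.comp, ← hs]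
      simp [Substitution.onWord, ← hr]
    · rw [incidenceBlock, ← Matrix.mulVec_mulVec, hq, Matrix.mulVec_add, hp, abel_append,
        abel_onWord, incidence_block, descend, zero_add, add_assoc]

theorem l1_le_of_euclNorm_le {x : Fin 3 → ℤ} {r : ℝ} (hx : euclNorm x ≤ r) :
    l1 x ≤ 3 * ⌈r⌉₊ := by
  have h : ∀ i, (x i).natAbs ≤ ⌈r⌉₊ := by
    intro i
    have h1 := PiLp.norm_apply_le (WithLp.toLp 2 (fun a => (x a : ℝ)) : EuclideanSpace ℝ (Fin 3)) i
    have h2 : ‖((x i : ℤ) : ℝ)‖ ≤ r := h1.trans hx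
    have h3 : (((x i).natAbs : ℕ) : ℝ) ≤ (⌈r⌉₊ : ℝ) := by
      rw [Nat.cast_natAbs, Int.cast_abs]
      exact h2.trans (Nat.le_ceil r)
    exact_mod_cast h3
  have g0 := h 0
  have g1 := h 1
  have g2 := h 2
  simp only [l1]
  omega

theorem Recurrent.exists_ge {A : Type*} {σ : ℕ → Substitution A} (hrec : Recurrent σ) (m q : ℕ) :
    ∃ n, q ≤ n ∧ σ n = σ m := by
  induction q with
  | zero => exact ⟨m, Nat.zero_le _, rfl⟩
  | succ q ih =>
    obtain ⟨n, hn, he⟩ := ih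
    obtain ⟨k, hk, h⟩ := hrec (n + 1)
    exact ⟨k + n, by omega, (h n (Nat.lt_succ_self n)).trans he⟩

end SAdic

theorem mainTheorem12 (σ : ℕ → SAdic.Substitution (Fin 3))
    (hAR : ∀ n, ∃ i : Fin 3, σ n = SAdic.arnouxRauzy i)
    (hrec : SAdic.Recurrent σ)
    (hall : ∀ i : Fin 3, ∃ n, σ n = SAdic.arnouxRauzy i) :
    SAdic.GeometricFiniteness σ := by
  choose a ha using hAR
  have hU : ∀ n, SAdic.IsUnimodular (σ n) := fun n => ha n ▸ SAdic.isUnimodular_arnouxRauzy _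
  have hT := SAdic.triangular_lengths ha
  have hS : ∀ n, SAdic.lengths σ (n + 1) =
      (SAdic.incidence (SAdic.arnouxRauzy (a n)))ᵀ *ᵥ SAdic.lengths σ n := fun n => by
    rw [SAdic.lengths_succ, ha]
  have hI : ∀ i q, ∃ n, q ≤ n ∧ a n = i := fun i q => by
    obtain ⟨m, hm⟩ := hall i
    obtain ⟨n, hn, he⟩ := hrec.exists_ge m q
    exact ⟨n, hn, SAdic.arnouxRauzy_injective ((ha n).symm.trans (he.trans hm))⟩
  choose N hN using SAdic.exists_descend_eq_zero hT hS hI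
  refine ⟨hU, fun r _ => ⟨(Finset.range (3 * ⌈r⌉₊ + 1)).sup N, fun n hn f hf => ?_⟩⟩
  obtain ⟨hf, hr⟩ := hf
  rw [SAdic.mem_discreteHyperplane_iff] at hf
  obtain ⟨h0, h1⟩ := hf
  have hslab : f.1 ∈ SAdic.slab (SAdic.lengths σ n) := by
    have := (hT n).two_mul_lt f.2
    exact ⟨h0, by omega⟩
  -- The length of the chain is bounded in terms of `r` alone, uniformly in `n`.
  obtain ⟨m, hm, hreach⟩ := SAdic.exists_reach (hT n) hslab
  have hm' : m ∈ Finset.range (3 * ⌈r⌉₊ + 1) := by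
    have := SAdic.l1_le_of_euclNorm_le hr
    rw [Finset.mem_range]
    omega
  have hz := hN m n ((Finset.le_sup hm').trans hn) f.1 hreach
  obtain ⟨p, j, hp, he⟩ := SAdic.exists_prefix ha n f.1 f.2 h0 h1
  rw [hz, add_zero] at he
  refine Set.mem_iUnion₂.2 ⟨(0, j), rfl, p, hp, ?_⟩
  rw [SAdic.incidence_block, zero_add, ← he, Matrix.mulVec_mulVec,
    Matrix.nonsing_inv_mul _ (SAdic.isUnit_det_incidenceBlock hU n), Matrix.one_mulVec]
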